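/- Let $N\ge 3$ and let $V\in L^\infty(\mathbb R^N)$ be real-valued and $\mathbb Z^N$-periodic with $\inf V>0$ (periodicity and infimum up to null sets). For $0<s<1$ let $H^s(\mathbb R^N)$ be the space of real-valued $u\in L^2(\mathbb R^N)$ with $$\int_{\mathbb R^N\times\mathbb R^N}\frac{|u(x)-u(y)|^2}{|x-y|^{N+2s}}\,dx\,dy<\infty,$$ with the norm $$\|u\|_s=\Big(\|(-\Delta)^{s/2}u\|_{L^2(\mathbb R^N)}^2+\int_{\mathbb R^N}V(x)\,u(x)^2\,dx\Big)^{1/2},$$ where $(-\Delta)^{s/2}$ is the operator in $L^2(\mathbb R^N)$ that multiplies the Fourier transform $\hat u(\xi)=\int u(x)e^{-2\pi i x\cdot\xi}\,dx$ by $(2\pi|\xi|)^{s}$. Let $r>0$ and $2\le q<\frac{2N}{N-1}$. Let $(s_n)_n\subset(1/2,1)$ and $u_n\in H^{s_n}(\mathbb R^N)$ be sequences such that $\|u_n\|_{s_n}\le M$ for all $n$, where $M>0$ does not depend on $n$. If $$\lim_{n\to\infty}\ \sup_{y\in\mathbb R^N}\int_{B(y,r)}|u_n|^q\,dx=0,$$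 then, for every $p\in\left(2,\frac{2N}{N-1}\right)$, all $u_n$ lie in $L^p(\mathbb R^N)$ and $u_n\to0$ in $L^p(\mathbb R^N)$. -/

import Mathlib

open MeasureTheory Filter Topology
open scoped ENNReal FourierTransform

noncomputable section

namespace FracSobolev

/-- Real square integrable functions on `ℝ^N`, modulo equality almost everywhere. -/
abbrev L2 (N : ℕ) : Type :=
  Lp (α := EuclideanSpace ℝ (Fin N)) ℝ 2 volume

/-- Complex square integrable functions on `ℝ^N`, modulo equality almost everywhere. -/
abbrev L2C (N : ℕ) : Type :=
  Lp (α := EuclideanSpace ℝ (Fin N)) ℂ 2 volume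

/-- A real `L²` function viewed as a complex one. -/
def complexify {N : ℕ} (u : L2 N) : L2C N :=
  Complex.ofRealCLM.compLp u

/-- The double integral `∬ |u(x) - u(y)|² / |x - y|^(N + 2 s) dx dy`, with values in `[0, ∞]`.
(The integrand is `0` on the diagonal, which is a null set.) -/
def gagliardoSq {N : ℕ} (s : ℝ) (u : L2 N) : ℝ≥0∞ :=
  ∫⁻ z : EuclideanSpace ℝ (Fin N) × EuclideanSpace ℝ (Fin N),
    ENNReal.ofReal (|u z.1 - u z.2| ^ 2 / ‖z.1 - z.2‖ ^ ((N : ℝ) + 2 * s))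
    ∂((volume : Measure (EuclideanSpace ℝ (Fin N))).prod volume)

/-- The fractional Sobolev space `H^s(ℝ^N)`, for `0 < s < 1`. -/
def Hs (N : ℕ) (s : ℝ) : Set (L2 N) :=
  {u | gagliardoSq s u < ∞}

/-- The function `ξ ↦ (2π|ξ|)^(2σ) û(ξ)`. Mathlib's Fourier transform has the kernel
`exp(-2πi x·ξ)`, so that `-Δ` has the symbol `(2π|ξ|)²`, and `(-Δ)^σ` the symbol `(2π|ξ|)^(2σ)`. -/
def fracSymbolMul {N : ℕ} (σ : ℝ) (u : L2C N) : EuclideanSpace ℝ (Fin N) → ℂ :=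
  fun ξ => (((2 * Real.pi * ‖ξ‖) ^ (2 * σ) : ℝ) : ℂ) * (𝓕 u : L2C N) ξ

/-- `u` is in the domain of `(-Δ)^σ` as an operator in `L²(ℝ^N)`. -/
def InFracDomain {N : ℕ} (σ : ℝ) (u : L2C N) : Prop :=
  MemLp (fracSymbolMul σ u) 2 volume

/-- The fractional Laplacian `(-Δ)^σ u ∈ L²(ℝ^N)` of a function in its domain. -/
def fracLaplacian {N : ℕ} (σ : ℝ) (u : L2C N) (h : InFracDomain σ u) : L2C N :=
  𝓕⁻ (MemLp.toLp (fracSymbolMul σ u) h)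

open Classical in
/-- The number `‖(-Δ)^σ u‖` in `L²(ℝ^N)`, which is `∞` if `(-Δ)^σ u` is not an `L²` function. -/
def fracLaplacianNorm {N : ℕ} (σ : ℝ) (u : L2 N) : ℝ≥0∞ :=
  if h : InFracDomain σ (complexify u) then ‖fracLaplacian σ (complexify u) h‖ₑ else ∞

/-- The assumption on the potential: `V ∈ L^∞(ℝ^N)` is `ℤ^N`-periodic and `inf V > 0`. As `V` is
an element of `L^∞`, periodicity and the infimum are understood up to null sets. -/
structure IsPotential {N : ℕ} (V : EuclideanSpace ℝ (Fin N) → ℝ) : Prop where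
  memLp : MemLp V ∞ volume
  periodic : ∀ z : Fin N → ℤ,
    ∀ᵐ x : EuclideanSpace ℝ (Fin N), V (x + WithLp.toLp 2 (fun i => (z i : ℝ))) = V x
  inf_pos : ∃ c : ℝ, 0 < c ∧ ∀ᵐ x : EuclideanSpace ℝ (Fin N), c ≤ V x

/-- The norm `‖u‖_s = (‖(-Δ)^(s/2) u‖² + ∫ V u²)^(1/2)`, with values in `[0, ∞]`. -/
def sNorm {N : ℕ} (V : EuclideanSpace ℝ (Fin N) → ℝ) (s : ℝ) (u : L2 N) : ℝ≥0∞ :=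
  (fracLaplacianNorm (s / 2) u ^ 2 + ∫⁻ x, ENNReal.ofReal (V x * u x ^ 2)) ^ (1 / 2 : ℝ)

end FracSobolev

end

/-!
A bound on `‖u‖_s` with `s > 1/2` controls `∫ (1 + 2π|ξ|) |û|²`, uniformly in `s`, because
`2π|ξ| ≤ 1 + (2π|ξ|)^(2s)`. By Plancherel and `|e^{iθ} - 1|² ≤ 2|θ|` this becomes the Nikolskii
bound `‖u(· + h) - u‖₂² ≤ K |h|` (`FracSobolev.nikolskiiBound_of_sNorm_le`), so that the orders
`s_n` play no role afterwards: `1/2` is the order whose critical exponent is `2N/(N-1)`.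

The rest takes place in physical space and rests on one level set estimate
(`NikolskiiBound.measure_lt_le`). If the integral of `|v|^q` over every ball of radius `ρ` is so
small that `|v| ≥ t/2` on at most half of each such ball, then around every point with `|v| > t`
the increments of `v` exceed `t/2` on half of the ball. Integrating over the increments gives
`|{|v| > t}| ≤ 8 K ρ / t²`. The estimate is used twice.

* With `ρ` depending on `t` and on `J ≥ ∫ |v|^p`, and with the layer cake formula, it gives
  `J ≤ a + β J^(1/2)` for every subcritical `p`, hence an `L^p` bound depending only on `K` and the
  `L²` norm (`NikolskiiBound.exists_lintegral_rpow_le`). Truncation, which preserves the Nikolskii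
  bound, supplies the finiteness of `∫ |v|^p` that the absorption needs.
* With `ρ ≤ r` fixed and small, the vanishing hypothesis gives `|{|u_n| > t}| → 0` for every `t`
  (`tendsto_measure_lt_of_vanishing`).

Splitting `∫ |u_n|^p` at a low and a high level, with the `L²` bound below and an `L^{p'}` bound,
`p < p' < 2N/(N-1)`, above, finishes the proof (`tendsto_lintegral_rpow_of_vanishing`).
-/

/-! ### Translations and the Fourier transform in `L²` -/

section Translation

open scoped InnerProductSpace SchwartzMap

variable {E : Type*} [NormedAddCommGroup E] [InnerProductSpace ℝ E] [FiniteDimensional ℝ E]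
  [MeasurableSpace E] [BorelSpace E]

omit [FiniteDimensional ℝ E] in
theorem measurable_fourierChar_inner_sub_one (h : E) :
    Measurable fun ξ : E => ((𝐞 ⟪h, ξ⟫_ℝ : Circle) : ℂ) - 1 := by
  refine (Continuous.sub ?_ continuous_const).measurable
  exact continuous_subtype_val.comp (Real.continuous_fourierChar.comp (by fun_prop))

theorem norm_fourierChar_sub_one_le_two (t : ℝ) : ‖((𝐞 t : Circle) : ℂ) - 1‖ ≤ 2 := by
  refine (norm_sub_le _ _).trans ?_
  simp only [Circle.norm_coe, norm_one]
  norm_num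

theorem norm_fourierChar_sub_one_sq_le (t : ℝ) :
    ‖((𝐞 t : Circle) : ℂ) - 1‖ ^ 2 ≤ 2 * (2 * Real.pi * |t|) := by
  have h1 : ‖((𝐞 t : Circle) : ℂ) - 1‖ ≤ 2 * Real.pi * |t| := by
    rw [Real.fourierChar_apply, mul_comm _ Complex.I]
    refine Real.norm_exp_I_mul_ofReal_sub_one_le.trans_eq ?_
    rw [norm_mul, Real.norm_of_nonneg Real.two_pi_pos.le, Real.norm_eq_abs]
  rw [sq]
  exact mul_le_mul (norm_fourierChar_sub_one_le_two t) h1 (norm_nonneg _) (by norm_num)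

theorem SchwartzMap.eLpNorm_fourier_eq (ψ : 𝓢(E, ℂ)) :
    eLpNorm (𝓕 ψ : 𝓢(E, ℂ)) 2 volume = eLpNorm ψ 2 volume := by
  rw [← eLpNorm_congr_ae ((𝓕 ψ : 𝓢(E, ℂ)).coeFn_toLp 2 volume),
    ← eLpNorm_congr_ae (ψ.coeFn_toLp 2 volume), ← Lp.enorm_def, ← Lp.enorm_def,
    enorm_eq_iff_norm_eq]
  exact SchwartzMap.norm_fourier_toL2_eq ψ

/-- Plancherel for increments of Schwartz functions: translation by `h` multiplies the Fourier
transform by the character `ξ ↦ 𝐞 ⟪h, ξ⟫`. -/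
theorem SchwartzMap.eLpNorm_translate_sub (φ : 𝓢(E, ℂ)) (h : E) :
    eLpNorm (fun x => φ (x + h) - φ x) 2 volume =
      eLpNorm (fun ξ => (((𝐞 ⟪h, ξ⟫_ℝ : Circle) : ℂ) - 1) * (𝓕 φ : 𝓢(E, ℂ)) ξ) 2 volume := by
  have key := SchwartzMap.eLpNorm_fourier_eq (φ.compSubConstCLM ℂ (-h) - φ)
  have h1 : ((φ.compSubConstCLM ℂ (-h) - φ : 𝓢(E, ℂ)) : E → ℂ) = fun x => φ (x + h) - φ x := by
    ext x
    simp
  have h2 : ((𝓕 (φ.compSubConstCLM ℂ (-h) - φ) : 𝓢(E, ℂ)) : E → ℂ) =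
      fun ξ => (((𝐞 ⟪h, ξ⟫_ℝ : Circle) : ℂ) - 1) * (𝓕 φ : 𝓢(E, ℂ)) ξ := by
    ext ξ
    have h3 : (𝓕 (φ.compSubConstCLM ℂ (-h)) : 𝓢(E, ℂ)) ξ =
        ((𝐞 ⟪h, ξ⟫_ℝ : Circle) : ℂ) * (𝓕 φ : 𝓢(E, ℂ)) ξ := by
      rw [SchwartzMap.fourier_coe, SchwartzMap.fourier_coe]
      have h4 : ((φ.compSubConstCLM ℂ (-h) : 𝓢(E, ℂ)) : E → ℂ) = (φ : E → ℂ) ∘ fun x => x + h := by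
        ext x
        simp
      rw [h4]
      have := congrFun (VectorFourier.fourierIntegral_comp_add_right 𝐞 (volume : Measure E)
        (innerₗ E) φ h) ξ
      rw [Circle.smul_def] at this
      exact this
    have h5 : (𝓕 (φ.compSubConstCLM ℂ (-h) - φ) : 𝓢(E, ℂ)) =
        𝓕 (φ.compSubConstCLM ℂ (-h)) - 𝓕 φ :=
      map_sub (SchwartzMap.fourierTransformCLM ℂ) _ _
    rw [h5, sub_apply, h3]
    ring
  rw [h1, h2] at key
  exact key.symm

theorem eLpNorm_comp_add_right {F : Type*} [NormedAddCommGroup F] {g : E → F}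
    (hg : AEStronglyMeasurable g volume) (p : ℝ≥0∞) (h : E) :
    eLpNorm (fun x => g (x + h)) p volume = eLpNorm g p volume :=
  eLpNorm_comp_measurePreserving hg (measurePreserving_add_right volume h)

theorem eLpNorm_translate_sub_le_add {F : Type*} [NormedAddCommGroup F] {g : E → F}
    (hg : AEStronglyMeasurable g volume) (h : E) :
    eLpNorm (fun x => g (x + h) - g x) 2 volume ≤ eLpNorm g 2 volume + eLpNorm g 2 volume := by
  have hτ : AEStronglyMeasurable (fun x => g (x + h)) volume :=
    hg.comp_measurePreserving (measurePreserving_add_right volume h)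
  refine (eLpNorm_sub_le hτ hg (by norm_num)).trans_eq ?_
  rw [eLpNorm_comp_add_right hg]

theorem eLpNorm_fourierChar_sub_one_mul_le {g : E → ℂ} (h : E) :
    eLpNorm (fun ξ => (((𝐞 ⟪h, ξ⟫_ℝ : Circle) : ℂ) - 1) * g ξ) 2 volume ≤
      2 * eLpNorm g 2 volume := by
  have := eLpNorm_le_mul_eLpNorm_of_ae_le_mul (μ := volume) (c := 2)
    (f := fun ξ => (((𝐞 ⟪h, ξ⟫_ℝ : Circle) : ℂ) - 1) * g ξ) (g := g)
    (ae_of_all _ fun ξ => by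
      rw [norm_mul]
      exact mul_le_mul_of_nonneg_right (norm_fourierChar_sub_one_le_two _) (norm_nonneg _)) 2
  simpa using this

theorem MeasureTheory.Lp.dist_fourier_fourier (u v : Lp (α := E) ℂ 2 volume) :
    dist (𝓕 u : Lp (α := E) ℂ 2 volume) (𝓕 v) = dist u v :=
  (Lp.fourierTransformₗᵢ E ℂ).isometry.dist_eq u v

/-- The inequality half of Plancherel for increments, on all of `L²`. Both sides are continuous in
`u`, so that it follows from the case of Schwartz functions by density. -/
theorem MeasureTheory.Lp.eLpNorm_translate_sub_le (u : Lp (α := E) ℂ 2 volume) (h : E) :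
    eLpNorm (fun x => u (x + h) - u x) 2 volume ≤
      eLpNorm (fun ξ => (((𝐞 ⟪h, ξ⟫_ℝ : Circle) : ℂ) - 1) * (𝓕 u : Lp (α := E) ℂ 2 volume) ξ)
        2 volume := by
  refine ENNReal.le_of_forall_pos_le_add fun ε hε _ => ?_
  have hε4 : 0 < (ε : ℝ) / 4 := by positivity
  obtain ⟨φ, hφ⟩ := (SchwartzMap.denseRange_toLpCLM (F := ℂ) (p := 2) (μ := (volume : Measure E))
    ENNReal.ofNat_ne_top).exists_dist_lt u hε4
  rw [SchwartzMap.toLpCLM_apply] at hφ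
  have hd1 : eLpNorm (fun x => u x - φ x) 2 volume ≤ ENNReal.ofReal (ε / 4) := by
    have h1 : eLpNorm (fun x => u x - φ x) 2 volume = edist u (φ.toLp 2) := by
      rw [Lp.edist_def]
      exact eLpNorm_congr_ae (by
        filter_upwards [φ.coeFn_toLp 2 volume] with x hx
        rw [Pi.sub_apply, hx])
    rw [h1, edist_dist]
    exact ENNReal.ofReal_le_ofReal hφ.le
  have hd2 : eLpNorm (fun x => (𝓕 φ : 𝓢(E, ℂ)) x - (𝓕 u : Lp (α := E) ℂ 2 volume) x) 2 volume ≤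
      ENNReal.ofReal (ε / 4) := by
    have h0 : dist (𝓕 (φ.toLp 2) : Lp (α := E) ℂ 2 volume) (𝓕 u) < ε / 4 := by
      rw [dist_comm, Lp.dist_fourier_fourier]
      exact hφ
    rw [SchwartzMap.toLp_fourier_eq] at h0
    have h1 : eLpNorm (fun x => (𝓕 φ : 𝓢(E, ℂ)) x - (𝓕 u : Lp (α := E) ℂ 2 volume) x) 2 volume =
        edist ((𝓕 φ : 𝓢(E, ℂ)).toLp 2) (𝓕 u : Lp (α := E) ℂ 2 volume) := by
      rw [Lp.edist_def]
      exact eLpNorm_congr_ae (by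
        filter_upwards [(𝓕 φ : 𝓢(E, ℂ)).coeFn_toLp 2 volume] with x hx
        rw [Pi.sub_apply, hx])
    rw [h1, edist_dist]
    exact ENNReal.ofReal_le_ofReal h0.le
  have mu : AEStronglyMeasurable u volume := Lp.aestronglyMeasurable u
  have mU : AEStronglyMeasurable (𝓕 u : Lp (α := E) ℂ 2 volume) volume :=
    Lp.aestronglyMeasurable _
  have mφ : AEStronglyMeasurable φ volume := φ.continuous.aestronglyMeasurable
  have mΦ : AEStronglyMeasurable (𝓕 φ : 𝓢(E, ℂ)) volume :=
    (𝓕 φ : 𝓢(E, ℂ)).continuous.aestronglyMeasurable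
  have mχ := (measurable_fourierChar_inner_sub_one h).aestronglyMeasurable (μ := volume)
  have mτ : MeasurePreserving (fun x : E => x + h) volume volume :=
    measurePreserving_add_right volume h
  have step1 : eLpNorm (fun x => u (x + h) - u x) 2 volume ≤
      (ENNReal.ofReal (ε / 4) + ENNReal.ofReal (ε / 4)) +
        eLpNorm (fun x => φ (x + h) - φ x) 2 volume := by
    have e : (fun x => u (x + h) - u x) = (fun x => (fun y => u y - φ y) (x + h) -
        (fun y => u y - φ y) x) + fun x => φ (x + h) - φ x := by
      ext x
      simp only [Pi.add_apply]
      ring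
    rw [e]
    have m1 : AEStronglyMeasurable (fun y => u y - φ y) volume := mu.sub mφ
    refine (eLpNorm_add_le ((m1.comp_measurePreserving mτ).sub m1)
      ((mφ.comp_measurePreserving mτ).sub mφ) (by norm_num)).trans ?_
    exact add_le_add ((eLpNorm_translate_sub_le_add m1 h).trans (add_le_add hd1 hd1)) le_rfl
  have step2 : eLpNorm (fun ξ => (((𝐞 ⟪h, ξ⟫_ℝ : Circle) : ℂ) - 1) * (𝓕 φ : 𝓢(E, ℂ)) ξ) 2 volume ≤
      2 * ENNReal.ofReal (ε / 4) + eLpNorm (fun ξ => (((𝐞 ⟪h, ξ⟫_ℝ : Circle) : ℂ) - 1) *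
        (𝓕 u : Lp (α := E) ℂ 2 volume) ξ) 2 volume := by
    have e : (fun ξ => (((𝐞 ⟪h, ξ⟫_ℝ : Circle) : ℂ) - 1) * (𝓕 φ : 𝓢(E, ℂ)) ξ) =
        (fun ξ => (((𝐞 ⟪h, ξ⟫_ℝ : Circle) : ℂ) - 1) *
          ((𝓕 φ : 𝓢(E, ℂ)) ξ - (𝓕 u : Lp (α := E) ℂ 2 volume) ξ)) +
        fun ξ => (((𝐞 ⟪h, ξ⟫_ℝ : Circle) : ℂ) - 1) * (𝓕 u : Lp (α := E) ℂ 2 volume) ξ := by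
      ext ξ
      simp only [Pi.add_apply]
      ring
    rw [e]
    refine (eLpNorm_add_le (mχ.mul (mΦ.sub mU)) (mχ.mul mU) (by norm_num)).trans ?_
    exact add_le_add ((eLpNorm_fourierChar_sub_one_mul_le h).trans
      (mul_le_mul_right hd2 2)) le_rfl
  rw [SchwartzMap.eLpNorm_translate_sub] at step1
  refine (step1.trans (add_le_add_right step2 _)).trans_eq ?_
  have e4 : (ε : ℝ≥0∞) = ENNReal.ofReal (ε / 4) + ENNReal.ofReal (ε / 4) +
      2 * ENNReal.ofReal (ε / 4) := by
    rw [two_mul, ← ENNReal.ofReal_add, ← ENNReal.ofReal_add, ← ENNReal.ofReal_coe_nnreal] <;>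
      first | positivity | skip
    congr 1
    ring
  rw [e4, ← add_assoc, add_comm _ (eLpNorm _ _ _)]

theorem lintegral_enorm_sq_eq_eLpNorm_sq {F : Type*} [NormedAddCommGroup F] (g : E → F) :
    ∫⁻ x, ‖g x‖ₑ ^ 2 = eLpNorm g 2 volume ^ 2 := by
  have := eLpNorm_nnreal_pow_eq_lintegral (f := g) (μ := volume) (p := 2) (by norm_num)
  simpa using this.symm

/-- The Nikolskii estimate of order one half: a weight `(2π|ξ|)^σ` with `σ ≥ 1/2`, together with
the `L²` norm, controls the frequency weight `2π|ξ|`, whatever `σ` is. -/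
theorem MeasureTheory.Lp.lintegral_translate_sub_sq_le (u : Lp (α := E) ℂ 2 volume) {σ : ℝ}
    (hσ : 1 / 2 ≤ σ) (h : E) :
    ∫⁻ x, ‖u (x + h) - u x‖ₑ ^ 2 ≤ ENNReal.ofReal (2 * ‖h‖) *
      ((∫⁻ x, ‖u x‖ₑ ^ 2) + ∫⁻ ξ, ‖(((2 * Real.pi * ‖ξ‖) ^ σ : ℝ) : ℂ) *
        (𝓕 u : Lp (α := E) ℂ 2 volume) ξ‖ₑ ^ 2) := by
  set U : Lp (α := E) ℂ 2 volume := 𝓕 u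
  have hU : ∫⁻ x, ‖u x‖ₑ ^ 2 = ∫⁻ ξ, ‖U ξ‖ₑ ^ 2 := by
    rw [lintegral_enorm_sq_eq_eLpNorm_sq, lintegral_enorm_sq_eq_eLpNorm_sq]
    congr 1
    rw [← Lp.enorm_def, ← Lp.enorm_def, enorm_eq_iff_norm_eq]
    exact (Lp.norm_fourier_eq u).symm
  have mU : AEMeasurable (fun ξ => ‖U ξ‖ₑ ^ 2) volume :=
    (Lp.aestronglyMeasurable U).enorm.pow_const 2
  rw [hU, ← lintegral_add_left' mU, ← lintegral_const_mul' _ _ ENNReal.ofReal_ne_top]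
  calc ∫⁻ x, ‖u (x + h) - u x‖ₑ ^ 2
      ≤ ∫⁻ ξ, ‖(((𝐞 ⟪h, ξ⟫_ℝ : Circle) : ℂ) - 1) * U ξ‖ₑ ^ 2 := by
        rw [lintegral_enorm_sq_eq_eLpNorm_sq, lintegral_enorm_sq_eq_eLpNorm_sq]
        exact pow_le_pow_left' (Lp.eLpNorm_translate_sub_le u h) 2
    _ ≤ _ := by
        refine lintegral_mono fun ξ => ?_
        have hr : 0 ≤ 2 * Real.pi * ‖ξ‖ := by positivity
        have h1 : 2 * Real.pi * ‖ξ‖ ≤ 1 + ((2 * Real.pi * ‖ξ‖) ^ σ) ^ 2 := by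
          rcases le_total (2 * Real.pi * ‖ξ‖) 1 with hle | hge
          · nlinarith [sq_nonneg ((2 * Real.pi * ‖ξ‖) ^ σ)]
          · have : (2 * Real.pi * ‖ξ‖) ^ (1 : ℝ) ≤ (2 * Real.pi * ‖ξ‖) ^ (σ * (2 : ℕ)) :=
              Real.rpow_le_rpow_of_exponent_le hge (by push_cast; linarith)
            rw [Real.rpow_one, Real.rpow_mul_natCast hr] at this
            linarith
        have h2 : ‖((𝐞 ⟪h, ξ⟫_ℝ : Circle) : ℂ) - 1‖ ^ 2 ≤
            2 * ‖h‖ * (1 + ((2 * Real.pi * ‖ξ‖) ^ σ) ^ 2) := by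
          refine (norm_fourierChar_sub_one_sq_le _).trans ?_
          have h3 : |⟪h, ξ⟫_ℝ| ≤ ‖h‖ * ‖ξ‖ := abs_real_inner_le_norm h ξ
          calc 2 * (2 * Real.pi * |⟪h, ξ⟫_ℝ|) ≤ 2 * (2 * Real.pi * (‖h‖ * ‖ξ‖)) := by gcongr
            _ = 2 * ‖h‖ * (2 * Real.pi * ‖ξ‖) := by ring
            _ ≤ _ := by gcongr
        have h4 : ‖(((𝐞 ⟪h, ξ⟫_ℝ : Circle) : ℂ) - 1) * U ξ‖ ^ 2 ≤ 2 * ‖h‖ * (‖U ξ‖ ^ 2 +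
            ‖(((2 * Real.pi * ‖ξ‖) ^ σ : ℝ) : ℂ) * U ξ‖ ^ 2) := by
          rw [norm_mul, norm_mul, Complex.norm_real, Real.norm_of_nonneg (by positivity), mul_pow,
            mul_pow]
          nlinarith [mul_le_mul_of_nonneg_right h2 (sq_nonneg ‖U ξ‖)]
        simp only [← ofReal_norm]
        rw [← ENNReal.ofReal_pow (norm_nonneg _), ← ENNReal.ofReal_pow (norm_nonneg _),
          ← ENNReal.ofReal_pow (norm_nonneg _), ← ENNReal.ofReal_add (by positivity)
          (by positivity), ← ENNReal.ofReal_mul (by positivity)]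
        exact ENNReal.ofReal_le_ofReal h4

end Translation

/-! ### Level sets and `L^p` bounds under a Nikolskii bound -/

section LevelSets

open Module

variable {E : Type*} [NormedAddCommGroup E] [InnerProductSpace ℝ E] [FiniteDimensional ℝ E]
  [MeasurableSpace E] [BorelSpace E]

/-- The homogeneous Besov (Nikolskii) bound of order one half in `L²`: the squared `L²` norm of the
increment `v(· + h) - v` is at most `K |h|`. -/
def NikolskiiBound (K : ℝ) (v : E → ℝ) : Prop :=
  ∀ h : E, ∫⁻ x, ‖v (x + h) - v x‖ₑ ^ 2 ≤ ENNReal.ofReal (K * ‖h‖)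

theorem NikolskiiBound.of_abs_sub_le {K : ℝ} {v w : E → ℝ} (hv : NikolskiiBound K v)
    (h : ∀ x y, |w x - w y| ≤ |v x - v y|) : NikolskiiBound K w := fun z =>
  (lintegral_mono fun x => pow_le_pow_left' (by
    simp only [Real.enorm_eq_ofReal_abs]
    exact ENNReal.ofReal_le_ofReal (h _ _)) 2).trans (hv z)

/-- If at most half of every ball of radius `ρ` lies in `{|v| ≥ t/2}`, then around each point of
`{|v| > t}` the increments of `v` are at least `t/2` on half of the ball, and averaging the
Nikolskii bound over the ball controls the measure of `{|v| > t}`. -/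
theorem NikolskiiBound.measure_lt_le_of_measure_ball_le {K : ℝ} {v : E → ℝ}
    (hv : NikolskiiBound K v) (hm : Measurable v) (hK : 0 ≤ K) {t ρ : ℝ} (ht : 0 < t) (hρ : 0 < ρ)
    (hsmall : ∀ x : E, volume (Metric.ball x ρ ∩ {y | t / 2 ≤ |v y|}) ≤
      volume (Metric.ball (0 : E) ρ) / 2) :
    volume {x | t < |v x|} ≤ ENNReal.ofReal (8 * K * ρ / t ^ 2) := by
  set B := Metric.ball (0 : E) ρ
  set b := volume B
  have hb0 : b ≠ 0 := (Metric.measure_ball_pos volume (0 : E) hρ).ne'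
  have hbt : b ≠ ∞ := measure_ball_lt_top.ne
  set S := {x | t < |v x|}
  have hinc : Measurable fun z : E × E => ‖v (z.1 + z.2) - v z.1‖ₑ ^ 2 := by fun_prop
  have hlow : ∀ x ∈ S, ENNReal.ofReal (t ^ 2 / 4) * (b / 2) ≤
      ∫⁻ h in B, ‖v (x + h) - v x‖ₑ ^ 2 := by
    intro x hx
    -- the increments from `x` that leave `{|v| ≥ t/2}` fill at least half of the ball
    set G := B ∩ {h | |v (x + h)| < t / 2}
    have hG : b / 2 ≤ volume G := by
      have h1 : volume (B ∩ {h | t / 2 ≤ |v (x + h)|}) ≤ b / 2 := by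
        have h2 : B ∩ {h | t / 2 ≤ |v (x + h)|} =
            (fun h => x + h) ⁻¹' (Metric.ball x ρ ∩ {y | t / 2 ≤ |v y|}) := by
          ext h
          simp [B]
        rw [h2, measure_preimage_add]
        exact hsmall x
      have h3 : b ≤ b / 2 + volume G := by
        refine (measure_mono ?_).trans ((measure_union_le _ _).trans (add_le_add h1 le_rfl))
        intro h hh
        rcases le_or_gt (t / 2) |v (x + h)| with h4 | h4
        · exact Or.inl ⟨hh, h4⟩
        · exact Or.inr ⟨hh, h4⟩
      nth_rewrite 1 [← ENNReal.add_halves b] at h3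
      exact (ENNReal.add_le_add_iff_left (ENNReal.div_ne_top hbt (by norm_num))).1 h3
    have hGm : MeasurableSet G := measurableSet_ball.inter
      (measurableSet_lt (by fun_prop) measurable_const)
    calc ENNReal.ofReal (t ^ 2 / 4) * (b / 2) ≤ ENNReal.ofReal (t ^ 2 / 4) * volume G := by gcongr
      _ = ∫⁻ _ in G, ENNReal.ofReal (t ^ 2 / 4) := (setLIntegral_const _ _).symm
      _ ≤ ∫⁻ h in G, ‖v (x + h) - v x‖ₑ ^ 2 := by
        refine setLIntegral_mono' hGm fun h hh => ?_
        have h5 : |v (x + h)| < t / 2 := hh.2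
        have h6 : t < |v x| := hx
        have h7 : t / 2 ≤ |v (x + h) - v x| := by
          have := abs_sub_abs_le_abs_sub (v x) (v (x + h))
          rw [abs_sub_comm (v x)] at this
          linarith
        rw [Real.enorm_eq_ofReal_abs, ← ENNReal.ofReal_pow (abs_nonneg _)]
        refine ENNReal.ofReal_le_ofReal ?_
        nlinarith
      _ ≤ _ := lintegral_mono_set Set.inter_subset_left
  have hSm : MeasurableSet S := measurableSet_lt measurable_const (by fun_prop)
  have hup : ENNReal.ofReal (t ^ 2 / 4) * (b / 2) * volume S ≤ ENNReal.ofReal (K * ρ) * b :=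
    calc ENNReal.ofReal (t ^ 2 / 4) * (b / 2) * volume S
        = ∫⁻ _ in S, ENNReal.ofReal (t ^ 2 / 4) * (b / 2) := (setLIntegral_const _ _).symm
      _ ≤ ∫⁻ x in S, ∫⁻ h in B, ‖v (x + h) - v x‖ₑ ^ 2 := setLIntegral_mono' hSm hlow
      _ ≤ ∫⁻ x, ∫⁻ h in B, ‖v (x + h) - v x‖ₑ ^ 2 := setLIntegral_le_lintegral _ _
      _ = ∫⁻ h in B, ∫⁻ x, ‖v (x + h) - v x‖ₑ ^ 2 := lintegral_lintegral_swap hinc.aemeasurable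
      _ ≤ ∫⁻ _ in B, ENNReal.ofReal (K * ρ) := by
        refine setLIntegral_mono' measurableSet_ball fun h hh => (hv h).trans ?_
        have : ‖h‖ < ρ := by simpa [B] using hh
        exact ENNReal.ofReal_le_ofReal (by gcongr)
      _ = ENNReal.ofReal (K * ρ) * b := setLIntegral_const _ _
  have h8 : ENNReal.ofReal (t ^ 2 / 4) * (b / 2) = ENNReal.ofReal (t ^ 2 / 8) * b := by
    rw [ENNReal.div_eq_inv_mul, ← mul_assoc]
    congr 1
    rw [show (2 : ℝ≥0∞)⁻¹ = ENNReal.ofReal (1 / 2) by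
      rw [one_div, ENNReal.ofReal_inv_of_pos two_pos, ENNReal.ofReal_ofNat],
      ← ENNReal.ofReal_mul (by positivity)]
    congr 1
    ring
  rw [h8, mul_assoc, mul_comm b, ← mul_assoc, ENNReal.mul_le_mul_iff_left hb0 hbt, mul_comm,
    ← ENNReal.le_div_iff_mul_le (Or.inl (by simp; positivity)) (Or.inl ENNReal.ofReal_ne_top),
    ← ENNReal.ofReal_div_of_pos (by positivity)] at hup
  refine hup.trans_eq ?_
  congr 1
  field_simp

theorem enorm_rpow_eq_ofReal (a : ℝ) {p : ℝ} (hp : 0 ≤ p) :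
    ‖a‖ₑ ^ p = ENNReal.ofReal (|a| ^ p) := by
  rw [Real.enorm_eq_ofReal_abs, ENNReal.ofReal_rpow_of_nonneg (abs_nonneg _) hp]

/-- The level set estimate under a bound on the local `L^q` integrals, by Chebyshev's inequality. -/
theorem NikolskiiBound.measure_lt_le {K : ℝ} {v : E → ℝ} (hv : NikolskiiBound K v)
    (hm : Measurable v) (hK : 0 ≤ K) {t ρ q : ℝ} (ht : 0 < t) (hρ : 0 < ρ) (hq : 0 < q)
    (hint : ∀ x : E, ∫⁻ y in Metric.ball x ρ, ‖v y‖ₑ ^ q ≤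
      ENNReal.ofReal ((t / 2) ^ q) * (volume (Metric.ball (0 : E) ρ) / 2)) :
    volume {x | t < |v x|} ≤ ENNReal.ofReal (8 * K * ρ / t ^ 2) := by
  refine hv.measure_lt_le_of_measure_ball_le hm hK ht hρ fun x => ?_
  have h0 : ENNReal.ofReal ((t / 2) ^ q) ≠ 0 := by simp; positivity
  have hms : MeasurableSet {y | t / 2 ≤ |v y|} := measurableSet_le measurable_const (by fun_prop)
  refine (ENNReal.mul_le_mul_iff_right h0 ENNReal.ofReal_ne_top).1 (le_trans ?_ (hint x))
  rw [Set.inter_comm, ← Measure.restrict_apply hms]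
  refine le_trans ?_ (mul_meas_ge_le_lintegral (μ := volume.restrict (Metric.ball x ρ))
    (f := fun y => ‖v y‖ₑ ^ q) (by fun_prop) (ENNReal.ofReal ((t / 2) ^ q)))
  refine mul_le_mul_right (measure_mono fun y hy => ?_) _
  simp only [Set.mem_ofPred_eq] at hy ⊢
  rw [enorm_rpow_eq_ofReal _ hq.le]
  exact ENNReal.ofReal_le_ofReal (Real.rpow_le_rpow (by positivity) hy hq.le)

theorem measure_lt_le_of_lintegral_sq_le {v : E → ℝ} (hm : Measurable v) {A t : ℝ} (ht : 0 < t)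
    (hA : ∫⁻ x, ‖v x‖ₑ ^ 2 ≤ ENNReal.ofReal A) :
    volume {x | t < |v x|} ≤ ENNReal.ofReal (A / t ^ 2) := by
  rw [ENNReal.ofReal_div_of_pos (by positivity),
    ENNReal.le_div_iff_mul_le (Or.inl (by simp; positivity)) (Or.inl ENNReal.ofReal_ne_top),
    mul_comm]
  refine le_trans ?_ ((mul_meas_ge_le_lintegral (f := fun x => ‖v x‖ₑ ^ 2) (by fun_prop)
    (ENNReal.ofReal (t ^ 2))).trans hA)
  refine mul_le_mul_right (measure_mono fun y hy => ?_) _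
  simp only [Set.mem_ofPred_eq] at hy ⊢
  rw [Real.enorm_eq_ofReal_abs, ← ENNReal.ofReal_pow (abs_nonneg _)]
  exact ENNReal.ofReal_le_ofReal (by gcongr)

theorem lintegral_rpow_Ioc_zero_one_lt_top {a : ℝ} (ha : -1 < a) :
    ∫⁻ t in Set.Ioc (0 : ℝ) 1, ENNReal.ofReal (t ^ a) < ∞ := by
  have h : IntegrableOn (fun t : ℝ => t ^ a) (Set.Ioc 0 1) :=
    (intervalIntegrable_iff_integrableOn_Ioc_of_le zero_le_one).1
      (intervalIntegral.intervalIntegrable_rpow' ha)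
  exact h.lintegral_lt_top

theorem lintegral_rpow_Ioi_one_lt_top {a : ℝ} (ha : a < -1) :
    ∫⁻ t in Set.Ioi (1 : ℝ), ENNReal.ofReal (t ^ a) < ∞ :=
  (integrableOn_Ioi_rpow_of_lt ha one_pos).lintegral_lt_top

/-- A priori `L^p` bound below the critical exponent `2d/(d-1)`. The radius in the level set
estimate is chosen in terms of `J ≥ ∫ |v|^p`; the layer cake formula then bounds `∫ |v|^p` by
`a + β J^(1/2)`, which can be absorbed since `∫ |v|^p` is finite. -/
theorem NikolskiiBound.exists_lintegral_rpow_le_of_ne_top (hd : 2 ≤ finrank ℝ E) {p K A : ℝ}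
    (hp : 2 < p) (hp' : p < 2 * (finrank ℝ E : ℝ) / ((finrank ℝ E : ℝ) - 1)) (hK : 0 ≤ K) :
    ∃ C : ℝ, ∀ v : E → ℝ, Measurable v → NikolskiiBound K v →
      ∫⁻ x, ‖v x‖ₑ ^ 2 ≤ ENNReal.ofReal A → ∫⁻ x, ‖v x‖ₑ ^ p ≠ ∞ →
        ∫⁻ x, ‖v x‖ₑ ^ p ≤ ENNReal.ofReal C := by
  set d : ℝ := (finrank ℝ E : ℝ)
  have hd2 : (2 : ℝ) ≤ d := Nat.ofNat_le_cast.2 hd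
  have hd0 : 0 < d := by linarith
  have hp0 : 0 < p := by linarith
  have hexp : p - 1 - 2 - p / d < -1 := by
    rw [lt_div_iff₀ (by linarith)] at hp'
    have : p - 2 < p / d := by
      rw [lt_div_iff₀ hd0]
      linarith
    linarith
  set ω := (volume (Metric.ball (0 : E) 1)).toReal
  have hω : 0 < ω := ENNReal.toReal_pos (Metric.measure_ball_pos volume _ one_pos).ne'
    measure_ball_lt_top.ne
  have hωe : volume (Metric.ball (0 : E) 1) = ENNReal.ofReal ω :=
    (ENNReal.ofReal_toReal measure_ball_lt_top.ne).symm
  set c₁ := (∫⁻ t in Set.Ioc (0 : ℝ) 1, ENNReal.ofReal (t ^ (p - 1 - 2))).toReal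
  set c₂ := (∫⁻ t in Set.Ioi (1 : ℝ), ENNReal.ofReal (t ^ (p - 1 - 2 - p / d))).toReal
  have hc₁ : ∫⁻ t in Set.Ioc (0 : ℝ) 1, ENNReal.ofReal (t ^ (p - 1 - 2)) = ENNReal.ofReal c₁ :=
    (ENNReal.ofReal_toReal (lintegral_rpow_Ioc_zero_one_lt_top (by linarith)).ne).symm
  have hc₂ : ∫⁻ t in Set.Ioi (1 : ℝ), ENNReal.ofReal (t ^ (p - 1 - 2 - p / d)) =
      ENNReal.ofReal c₂ :=
    (ENNReal.ofReal_toReal (lintegral_rpow_Ioi_one_lt_top hexp).ne).symm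
  set D := (2 ^ (p + 1) / ω) ^ (1 / d)
  have hD : 0 ≤ D := by positivity
  set a := p * (|A| * c₁)
  set β := p * (8 * K * D * c₂)
  have hc₁0 : 0 ≤ c₁ := ENNReal.toReal_nonneg
  have hc₂0 : 0 ≤ c₂ := ENNReal.toReal_nonneg
  have ha : 0 ≤ a := by positivity
  have hβ : 0 ≤ β := by positivity
  refine ⟨2 * (1 + a) + β ^ 2, fun v hm hv hA hfin => ?_⟩
  set I := ∫⁻ x, ‖v x‖ₑ ^ p
  -- `J ≥ 1` makes the radius below positive and gives `J^(1/d) ≤ √J`, which can be absorbed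
  set J := max 1 I.toReal
  have hJ1 : 1 ≤ J := le_max_left _ _
  have hJ0 : 0 < J := by linarith
  have hIJ : I ≤ ENNReal.ofReal J :=
    (ENNReal.le_ofReal_iff_toReal_le hfin hJ0.le).2 (le_max_right _ _)
  have hJd : J ^ (1 / d) ≤ √J := by
    rw [Real.sqrt_eq_rpow]
    exact Real.rpow_le_rpow_of_exponent_le hJ1 (by gcongr)
  have hlevel : ∀ t : ℝ, 0 < t →
      volume {x | t < |v x|} ≤ ENNReal.ofReal (8 * K * D * √J * t ^ (-2 - p / d)) := by
    intro t ht
    -- the radius for which the ball average of `|v|^p` is at most `(t/2)^p / 2`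
    set ρ := D * J ^ (1 / d) * t ^ (-(p / d))
    have hD0 : 0 < D := by positivity
    have hρ : 0 < ρ := by positivity
    have hρd : ρ ^ finrank ℝ E = 2 ^ (p + 1) / ω * J * t ^ (-p) := by
      have h1 : ∀ x : ℝ, 0 ≤ x → (x ^ (1 / d)) ^ finrank ℝ E = x := fun x hx => by
        rw [← Real.rpow_mul_natCast hx, one_div_mul_cancel hd0.ne', Real.rpow_one]
      rw [mul_pow, mul_pow, h1 _ (by positivity), h1 _ hJ0.le, ← Real.rpow_mul_natCast ht.le]
      congr 2
      change -(p / d) * d = -p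
      field_simp
    refine (hv.measure_lt_le hm hK ht hρ hp0 fun x => ?_).trans (ENNReal.ofReal_le_ofReal ?_)
    · refine (setLIntegral_le_lintegral _ _).trans (hIJ.trans_eq ?_)
      rw [Measure.addHaar_ball_of_pos _ _ hρ, hωe, ← ENNReal.ofReal_mul (by positivity),
        show (2 : ℝ≥0∞) = ENNReal.ofReal 2 by simp, ← ENNReal.ofReal_div_of_pos two_pos,
        ← ENNReal.ofReal_mul (by positivity), hρd]
      congr 1
      rw [Real.div_rpow ht.le two_pos.le, Real.rpow_neg ht.le, Real.rpow_add two_pos, Real.rpow_one]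
      field_simp
    · have h2 : t ^ (-2 - p / d) = t ^ (-(p / d)) / t ^ 2 := by
        rw [sub_eq_neg_add, ← sub_eq_add_neg, Real.rpow_sub ht]
        norm_cast
      rw [h2]
      calc 8 * K * ρ / t ^ 2 = 8 * K * D * J ^ (1 / d) * (t ^ (-(p / d)) / t ^ 2) := by ring
        _ ≤ _ := by gcongr
  have hI : I ≤ ENNReal.ofReal (a + β * √J) := by
    have hcake : I = ENNReal.ofReal p *
        ∫⁻ t in Set.Ioi 0, volume {x | t < |v x|} * ENNReal.ofReal (t ^ (p - 1)) := by
      rw [← lintegral_rpow_eq_lintegral_meas_lt_mul _ (ae_of_all _ fun x => abs_nonneg (v x))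
        (by fun_prop) hp0]
      exact lintegral_congr fun x => enorm_rpow_eq_ofReal _ hp0.le
    have hlow : ∫⁻ t in Set.Ioc 0 1, volume {x | t < |v x|} * ENNReal.ofReal (t ^ (p - 1)) ≤
        ENNReal.ofReal (|A| * c₁) := by
      rw [ENNReal.ofReal_mul (abs_nonneg A), ← hc₁,
        ← lintegral_const_mul' _ _ ENNReal.ofReal_ne_top]
      refine setLIntegral_mono' measurableSet_Ioc fun t ht => ?_
      refine (mul_le_mul_left (measure_lt_le_of_lintegral_sq_le hm ht.1 hA) _).trans ?_
      rw [← ENNReal.ofReal_mul' (Real.rpow_nonneg ht.1.le _), ← ENNReal.ofReal_mul (abs_nonneg A)]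
      refine ENNReal.ofReal_le_ofReal ?_
      have ht0 := ht.1
      rw [Real.rpow_sub ht.1 (p - 1) 2, show t ^ (2 : ℝ) = t ^ 2 by norm_cast]
      calc A / t ^ 2 * t ^ (p - 1) = A * (t ^ (p - 1) / t ^ 2) := by ring
        _ ≤ _ := by
          gcongr
          exact le_abs_self A
    have hhigh : ∫⁻ t in Set.Ioi 1, volume {x | t < |v x|} * ENNReal.ofReal (t ^ (p - 1)) ≤
        ENNReal.ofReal (8 * K * D * √J * c₂) := by
      rw [ENNReal.ofReal_mul (by positivity), ← hc₂,
        ← lintegral_const_mul' _ _ ENNReal.ofReal_ne_top]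
      refine setLIntegral_mono' measurableSet_Ioi fun t ht => ?_
      have ht0 : 0 < t := one_pos.trans ht
      refine (mul_le_mul_left (hlevel t ht0) _).trans_eq ?_
      rw [← ENNReal.ofReal_mul (by positivity), ← ENNReal.ofReal_mul (by positivity), mul_assoc,
        ← Real.rpow_add ht0]
      congr 3
      ring
    rw [hcake, ← Set.Ioc_union_Ioi_eq_Ioi zero_le_one,
      lintegral_union measurableSet_Ioi Set.Ioc_disjoint_Ioi_same]
    refine (mul_le_mul_right (add_le_add hlow hhigh) _).trans_eq ?_
    rw [← ENNReal.ofReal_add (by positivity) (by positivity), ← ENNReal.ofReal_mul hp0.le]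
    congr 1
    simp only [a, β]
    ring
  have hJle : J ≤ 1 + (a + β * √J) := by
    have h1 : I.toReal ≤ a + β * √J := ENNReal.toReal_le_of_le_ofReal (by positivity) hI
    exact max_le (by linarith [mul_nonneg hβ (Real.sqrt_nonneg J)]) (by linarith)
  refine hIJ.trans (ENNReal.ofReal_le_ofReal ?_)
  nlinarith [Real.sq_sqrt hJ0.le, sq_nonneg (β - √J)]

/-- The bound for all functions: truncations `min |v| n` satisfy the same hypotheses and lie in
every `L^p` with `p ≥ 2`. -/
theorem NikolskiiBound.exists_lintegral_rpow_le (hd : 2 ≤ finrank ℝ E) {p K A : ℝ}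
    (hp : 2 < p) (hp' : p < 2 * (finrank ℝ E : ℝ) / ((finrank ℝ E : ℝ) - 1)) (hK : 0 ≤ K) :
    ∃ C : ℝ, ∀ v : E → ℝ, Measurable v → NikolskiiBound K v →
      ∫⁻ x, ‖v x‖ₑ ^ 2 ≤ ENNReal.ofReal A → ∫⁻ x, ‖v x‖ₑ ^ p ≤ ENNReal.ofReal C := by
  obtain ⟨C, hC⟩ := NikolskiiBound.exists_lintegral_rpow_le_of_ne_top (E := E) (A := A) hd hp hp' hK
  refine ⟨C, fun v hm hv hA => ?_⟩
  have hp0 : 0 < p := by linarith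
  have hmono : ∀ x : E, Monotone fun n : ℕ => min |v x| n := fun x m n hmn =>
    min_le_min le_rfl (by exact_mod_cast hmn)
  have hnn : ∀ (x : E) (n : ℕ), 0 ≤ min |v x| n := fun x n => le_min (abs_nonneg _) n.cast_nonneg
  have hlim : Tendsto (fun n : ℕ => ∫⁻ x, ‖min |v x| (n : ℝ)‖ₑ ^ p) atTop
      (𝓝 (∫⁻ x, ‖v x‖ₑ ^ p)) := by
    refine lintegral_tendsto_of_tendsto_of_monotone (fun n => by fun_prop)
      (ae_of_all _ fun x m n hmn => ?_) (ae_of_all _ fun x => ?_)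
    · simp only [enorm_rpow_eq_ofReal _ hp0.le, abs_of_nonneg (hnn _ _)]
      exact ENNReal.ofReal_le_ofReal (Real.rpow_le_rpow (hnn _ _) (hmono x hmn) hp0.le)
    · obtain ⟨n₀, hn₀⟩ := exists_nat_ge |v x|
      refine tendsto_const_nhds.congr' ?_
      filter_upwards [eventually_ge_atTop n₀] with n hn
      rw [min_eq_left (hn₀.trans (by exact_mod_cast hn)), Real.enorm_abs]
  refine le_of_tendsto' hlim fun n => hC _ (by fun_prop) ?_ ?_ ?_
  · refine hv.of_abs_sub_le fun x y => ?_
    exact (abs_min_sub_min_le_max _ _ _ _).trans (by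
      simpa using abs_abs_sub_abs_le_abs_sub (v x) (v y))
  · refine (lintegral_mono fun x => pow_le_pow_left' ?_ 2).trans hA
    rw [Real.enorm_eq_ofReal_abs, Real.enorm_eq_ofReal_abs, abs_of_nonneg (hnn _ _)]
    exact ENNReal.ofReal_le_ofReal (min_le_left _ _)
  · refine ne_top_of_le_ne_top (b := ENNReal.ofReal ((n : ℝ) ^ (p - 2)) * ENNReal.ofReal A)
      (ENNReal.mul_ne_top ENNReal.ofReal_ne_top ENNReal.ofReal_ne_top) ?_
    refine le_trans ?_ (mul_le_mul_right hA _)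
    rw [← lintegral_const_mul' _ _ ENNReal.ofReal_ne_top]
    refine lintegral_mono fun x => ?_
    rw [enorm_rpow_eq_ofReal _ hp0.le, abs_of_nonneg (hnn _ _), Real.enorm_eq_ofReal_abs,
      ← ENNReal.ofReal_pow (abs_nonneg _), ← ENNReal.ofReal_mul (by positivity)]
    refine ENNReal.ofReal_le_ofReal ?_
    have h1 : (min |v x| n) ^ p = (min |v x| n) ^ (p - 2) * (min |v x| n) ^ 2 := by
      rw [← Real.rpow_add_natCast' (hnn _ _) (by push_cast; linarith)]
      congr 1
      push_cast
      ring
    rw [h1]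
    exact mul_le_mul (Real.rpow_le_rpow (hnn _ _) (min_le_right _ _) (by linarith))
      (pow_le_pow_left₀ (hnn _ _) (min_le_left _ _) 2) (by have := hnn x n; positivity)
      (by positivity)

/-- Vanishing of the local `L^q` integrals, uniformly over the balls of one radius, forces the
measure of every level set to vanish: balls of any smaller radius can be used in the level set
estimate. -/
theorem tendsto_measure_lt_of_vanishing {K q r : ℝ} (hK : 0 ≤ K) (hq : 0 < q) (hr : 0 < r)
    {v : ℕ → E → ℝ} (hm : ∀ n, Measurable (v n)) (hv : ∀ n, NikolskiiBound K (v n))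
    (hvanish : Tendsto (fun n => ⨆ y : E, ∫⁻ x in Metric.ball y r, ‖v n x‖ₑ ^ q) atTop (𝓝 0))
    {t : ℝ} (ht : 0 < t) :
    Tendsto (fun n => volume {x | t < |v n x|}) atTop (𝓝 0) := by
  rw [ENNReal.tendsto_nhds_zero]
  intro ε hε
  obtain ⟨ρ, hρ, hρr, hρε⟩ : ∃ ρ : ℝ, 0 < ρ ∧ ρ ≤ r ∧ ENNReal.ofReal (8 * K * ρ / t ^ 2) ≤ ε := by
    have h1 : Tendsto (fun ρ : ℝ => ENNReal.ofReal (8 * K * ρ / t ^ 2)) (𝓝[>] 0) (𝓝 0) := by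
      have h2 : Continuous fun ρ : ℝ => ENNReal.ofReal (8 * K * ρ / t ^ 2) :=
        ENNReal.continuous_ofReal.comp (by fun_prop)
      have h3 := (h2.tendsto 0).mono_left (nhdsWithin_le_nhds (s := Set.Ioi 0))
      simpa using h3
    obtain ⟨ρ, h2, h3, h4⟩ := ((h1.eventually_le_const hε).and
      ((eventually_mem_nhdsWithin (a := (0 : ℝ)) (s := Set.Ioi 0)).and
        (nhdsWithin_le_nhds (Iic_mem_nhds hr)))).exists
    exact ⟨ρ, h3, h4, h2⟩
  have hpos : 0 < ENNReal.ofReal ((t / 2) ^ q) * (volume (Metric.ball (0 : E) ρ) / 2) :=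
    ENNReal.mul_pos (by simp; positivity)
      (ENNReal.div_pos (Metric.measure_ball_pos volume _ hρ).ne' (by norm_num)).ne'
  filter_upwards [hvanish.eventually_le_const hpos] with n hn
  refine ((hv n).measure_lt_le (hm n) hK ht hρ hq fun x => ?_).trans hρε
  refine (lintegral_mono_set (Metric.ball_subset_ball hρr)).trans (le_trans ?_ hn)
  exact le_iSup (fun y : E => ∫⁻ x in Metric.ball y r, ‖v n x‖ₑ ^ q) x

/-- Pointwise splitting of `a^p` at a low level `t` and a high level `T`. -/
theorem rpow_le_add_indicator_add {a t T p p' : ℝ} (ha : 0 ≤ a) (ht : 0 ≤ t) (hT : 0 < T)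
    (hp : 2 < p) (hpp' : p ≤ p') :
    a ^ p ≤ t ^ (p - 2) * a ^ 2 + (Set.Ioi t).indicator (fun _ => T ^ p) a +
      T ^ (p - p') * a ^ p' := by
  have h1 : 0 ≤ t ^ (p - 2) * a ^ 2 := by positivity
  have h2 : 0 ≤ (Set.Ioi t).indicator (fun _ => T ^ p) a :=
    Set.indicator_nonneg (fun _ _ => by positivity) a
  have h3 : 0 ≤ T ^ (p - p') * a ^ p' := by positivity
  rcases le_or_gt a t with hat | hat
  · have h4 : a ^ p = a ^ (p - 2) * a ^ 2 := by
      rw [← Real.rpow_add_natCast' ha (by push_cast; linarith)]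
      congr 1
      push_cast
      ring
    have h5 : a ^ (p - 2) ≤ t ^ (p - 2) := Real.rpow_le_rpow ha hat (by linarith)
    have := mul_le_mul_of_nonneg_right h5 (sq_nonneg a)
    linarith
  rcases le_or_gt a T with haT | haT
  · rw [Set.indicator_of_mem (Set.mem_Ioi.2 hat)] at h2 ⊢
    have : a ^ p ≤ T ^ p := Real.rpow_le_rpow ha haT (by linarith)
    linarith
  · have ha0 : 0 < a := hT.trans haT
    have h4 : a ^ p = a ^ (p - p') * a ^ p' := by
      rw [← Real.rpow_add ha0, sub_add_cancel]
    have h5 : a ^ (p - p') ≤ T ^ (p - p') :=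
      Real.rpow_le_rpow_of_nonpos hT haT.le (by linarith)
    have := mul_le_mul_of_nonneg_right h5 (Real.rpow_nonneg ha p')
    linarith

/-- Lions' vanishing principle under a uniform Nikolskii bound. The integral of `|v|^p` is split
at a low and at a high level; the low part is controlled by the `L²` norm, the high part by the
`L^{p'}` norm with `p < p'` still subcritical, and the middle part by the measure of a level set. -/
theorem tendsto_lintegral_rpow_of_vanishing (hd : 2 ≤ finrank ℝ E) {p q r K A : ℝ}
    (hp : 2 < p) (hp' : p < 2 * (finrank ℝ E : ℝ) / ((finrank ℝ E : ℝ) - 1)) (hK : 0 ≤ K)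
    (hq : 0 < q) (hr : 0 < r)
    {v : ℕ → E → ℝ} (hm : ∀ n, Measurable (v n)) (hv : ∀ n, NikolskiiBound K (v n))
    (hA : ∀ n, ∫⁻ x, ‖v n x‖ₑ ^ 2 ≤ ENNReal.ofReal A)
    (hvanish : Tendsto (fun n => ⨆ y : E, ∫⁻ x in Metric.ball y r, ‖v n x‖ₑ ^ q) atTop (𝓝 0)) :
    Tendsto (fun n => ∫⁻ x, ‖v n x‖ₑ ^ p) atTop (𝓝 0) := by
  obtain ⟨p', hpp', hp'2⟩ := exists_between hp'
  obtain ⟨C, hC⟩ := NikolskiiBound.exists_lintegral_rpow_le (E := E) (A := A) hd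
    (hp.trans hpp') hp'2 hK
  have hsplit : ∀ t T : ℝ, 0 ≤ t → 0 < T → ∀ n, ∫⁻ x, ‖v n x‖ₑ ^ p ≤
      ENNReal.ofReal (t ^ (p - 2)) * ENNReal.ofReal A +
        ENNReal.ofReal (T ^ p) * volume {x | t < |v n x|} +
          ENNReal.ofReal (T ^ (p - p')) * ENNReal.ofReal C := by
    intro t T ht hT n
    have hms : MeasurableSet {x | t < |v n x|} :=
      measurableSet_lt measurable_const (hm n).abs
    have hmn := hm n
    calc ∫⁻ x, ‖v n x‖ₑ ^ p
        ≤ ∫⁻ x, (ENNReal.ofReal (t ^ (p - 2)) * ‖v n x‖ₑ ^ 2 +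
          {x | t < |v n x|}.indicator (fun _ => ENNReal.ofReal (T ^ p)) x) +
            ENNReal.ofReal (T ^ (p - p')) * ‖v n x‖ₑ ^ p' := by
          refine lintegral_mono fun x => ?_
          have h1 : {x | t < |v n x|}.indicator (fun _ => ENNReal.ofReal (T ^ p)) x =
              ENNReal.ofReal ((Set.Ioi t).indicator (fun _ => T ^ p) |v n x|) := by
            by_cases hx : t < |v n x| <;> simp [Set.indicator, hx]
          rw [h1, enorm_rpow_eq_ofReal _ (by linarith), enorm_rpow_eq_ofReal _ (by linarith),
            Real.enorm_eq_ofReal_abs, ← ENNReal.ofReal_pow (abs_nonneg _),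
            ← ENNReal.ofReal_mul (by positivity), ← ENNReal.ofReal_mul (by positivity),
            ← ENNReal.ofReal_add (by positivity)
              (Set.indicator_nonneg (fun _ _ => by positivity) _),
            ← ENNReal.ofReal_add (add_nonneg (by positivity)
              (Set.indicator_nonneg (fun _ _ => by positivity) _)) (by positivity)]
          exact ENNReal.ofReal_le_ofReal
            (rpow_le_add_indicator_add (abs_nonneg _) ht hT hp hpp'.le)
      _ = ENNReal.ofReal (t ^ (p - 2)) * (∫⁻ x, ‖v n x‖ₑ ^ 2) +
          ENNReal.ofReal (T ^ p) * volume {x | t < |v n x|} +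
            ENNReal.ofReal (T ^ (p - p')) * ∫⁻ x, ‖v n x‖ₑ ^ p' := by
          rw [lintegral_add_right _ (by fun_prop), lintegral_add_left (by fun_prop),
            lintegral_const_mul' _ _ ENNReal.ofReal_ne_top,
            lintegral_const_mul' _ _ ENNReal.ofReal_ne_top, lintegral_indicator_const hms]
      _ ≤ _ := add_le_add (add_le_add (mul_le_mul_right (hA n) _) le_rfl)
          (mul_le_mul_right (hC _ hmn (hv n) (hA n)) _)
  rw [ENNReal.tendsto_nhds_zero]
  intro ε hε
  have hε3 : 0 < ε / 3 := ENNReal.div_pos hε.ne' (by norm_num)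
  obtain ⟨t, ht, htε⟩ : ∃ t : ℝ, 0 < t ∧
      ENNReal.ofReal (t ^ (p - 2)) * ENNReal.ofReal A ≤ ε / 3 := by
    have h1 : Tendsto (fun t : ℝ => ENNReal.ofReal (t ^ (p - 2)) * ENNReal.ofReal A) (𝓝[>] 0)
        (𝓝 0) := by
      have h2 : Continuous fun t : ℝ => ENNReal.ofReal (t ^ (p - 2)) :=
        ENNReal.continuous_ofReal.comp (Real.continuous_rpow_const (by linarith))
      have h3 := ENNReal.Tendsto.mul_const (b := ENNReal.ofReal A) ((h2.tendsto 0).mono_left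
        (nhdsWithin_le_nhds (s := Set.Ioi 0))) (Or.inr ENNReal.ofReal_ne_top)
      simpa [Real.zero_rpow (by linarith : p - 2 ≠ 0)] using h3
    obtain ⟨t, h2, h3⟩ := ((h1.eventually_le_const hε3).and
      (eventually_mem_nhdsWithin (a := (0 : ℝ)) (s := Set.Ioi 0))).exists
    exact ⟨t, h3, h2⟩
  obtain ⟨T, hT, hTε⟩ : ∃ T : ℝ, 0 < T ∧
      ENNReal.ofReal (T ^ (p - p')) * ENNReal.ofReal C ≤ ε / 3 := by
    have h1 : Tendsto (fun T : ℝ => ENNReal.ofReal (T ^ (p - p')) * ENNReal.ofReal C) atTop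
        (𝓝 0) := by
      have h2 := ENNReal.tendsto_ofReal (tendsto_rpow_neg_atTop (sub_pos.2 hpp'))
      have h3 := ENNReal.Tendsto.mul_const (b := ENNReal.ofReal C) h2
        (Or.inr ENNReal.ofReal_ne_top)
      simpa using h3
    obtain ⟨T, h2, h3⟩ := ((h1.eventually_le_const hε3).and (eventually_gt_atTop 0)).exists
    exact ⟨T, h3, h2⟩
  have hmid : Tendsto (fun n => ENNReal.ofReal (T ^ p) * volume {x | t < |v n x|}) atTop
      (𝓝 0) := by
    simpa using ENNReal.Tendsto.const_mul (a := ENNReal.ofReal (T ^ p))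
      (tendsto_measure_lt_of_vanishing hK hq hr hm hv hvanish ht) (Or.inr ENNReal.ofReal_ne_top)
  filter_upwards [hmid.eventually_le_const hε3] with n hn
  calc ∫⁻ x, ‖v n x‖ₑ ^ p ≤ _ := hsplit t T ht.le hT n
    _ ≤ ε / 3 + ε / 3 + ε / 3 := add_le_add (add_le_add htε hn) hTε
    _ = ε := ENNReal.add_thirds ε

end LevelSets

/-! ### From the norm of `H^s` to the Nikolskii bound -/

namespace FracSobolev

/-- Plancherel for `(-Δ)^σ u`; a finite norm excludes the junk value `∞` off the domain. -/
theorem lintegral_enorm_fracSymbolMul_sq {N : ℕ} {σ : ℝ} {u : L2 N}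
    (h : fracLaplacianNorm σ u ≠ ∞) :
    ∫⁻ ξ, ‖fracSymbolMul σ (complexify u) ξ‖ₑ ^ 2 = fracLaplacianNorm σ u ^ 2 := by
  by_cases hd : InFracDomain σ (complexify u)
  · rw [fracLaplacianNorm, dif_pos hd, fracLaplacian, lintegral_enorm_sq_eq_eLpNorm_sq]
    congr 1
    rw [← Lp.enorm_toLp (hf := hd), enorm_eq_iff_norm_eq]
    exact ((Lp.fourierTransformₗᵢ (EuclideanSpace ℝ (Fin N)) ℂ).symm.norm_map _).symm
  · exact absurd (by rw [fracLaplacianNorm, dif_neg hd]) h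

theorem nikolskiiBound_of_sNorm_le {N : ℕ} {V : EuclideanSpace ℝ (Fin N) → ℝ} {c M s : ℝ}
    (hc : 0 < c) (hcV : ∀ᵐ x, c ≤ V x) (hM : 0 ≤ M) (hs : 1 / 2 ≤ s) {u : L2 N}
    (hu : sNorm V s u ≤ ENNReal.ofReal M) :
    ∫⁻ x, ‖u x‖ₑ ^ 2 ≤ ENNReal.ofReal (M ^ 2 / c) ∧
      NikolskiiBound (2 * (M ^ 2 / c + M ^ 2)) u := by
  have h1 : fracLaplacianNorm (s / 2) u ^ 2 + ∫⁻ x, ENNReal.ofReal (V x * u x ^ 2) ≤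
      ENNReal.ofReal (M ^ 2) := by
    have h2 := ENNReal.rpow_le_rpow hu (z := 2) (by norm_num)
    rw [sNorm, ← ENNReal.rpow_mul, ENNReal.ofReal_rpow_of_nonneg hM (by norm_num)] at h2
    norm_num at h2
    exact h2
  have hL2 : ∫⁻ x, ‖u x‖ₑ ^ 2 ≤ ENNReal.ofReal (M ^ 2 / c) := by
    rw [ENNReal.ofReal_div_of_pos hc, ENNReal.le_div_iff_mul_le (Or.inl (by simpa))
      (Or.inl ENNReal.ofReal_ne_top), mul_comm, ← lintegral_const_mul' _ _ ENNReal.ofReal_ne_top]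
    refine le_trans (lintegral_mono_ae ?_) (le_add_self.trans h1)
    filter_upwards [hcV] with x hx
    rw [Real.enorm_eq_ofReal_abs, ← ENNReal.ofReal_pow (abs_nonneg _), sq_abs,
      ← ENNReal.ofReal_mul hc.le]
    exact ENNReal.ofReal_le_ofReal (by gcongr)
  refine ⟨hL2, fun h => ?_⟩
  have hfr : fracLaplacianNorm (s / 2) u ^ 2 ≤ ENNReal.ofReal (M ^ 2) := le_self_add.trans h1
  have hfin : fracLaplacianNorm (s / 2) u ≠ ∞ := fun hinf => by simp [hinf] at hfr
  have hae : ∀ᵐ x, complexify u x = (u x : ℂ) := Complex.ofRealCLM.coeFn_compLp u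
  have hτ : ∀ᵐ x, complexify u (x + h) = (u (x + h) : ℂ) :=
    (measurePreserving_add_right volume h).quasiMeasurePreserving.ae hae
  have e1 : ∫⁻ x, ‖u (x + h) - u x‖ₑ ^ 2 =
      ∫⁻ x, ‖complexify u (x + h) - complexify u x‖ₑ ^ 2 := by
    refine lintegral_congr_ae ?_
    filter_upwards [hae, hτ] with x h3 h4
    rw [h3, h4, ← Complex.ofReal_sub, enorm_eq_iff_norm_eq.2 (Complex.norm_real _)]
  have e2 : ∫⁻ x, ‖complexify u x‖ₑ ^ 2 = ∫⁻ x, ‖u x‖ₑ ^ 2 := by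
    refine lintegral_congr_ae ?_
    filter_upwards [hae] with x h3
    rw [h3, enorm_eq_iff_norm_eq.2 (Complex.norm_real _)]
  have e3 := lintegral_enorm_fracSymbolMul_sq hfin
  simp only [fracSymbolMul, mul_div_cancel₀ s (two_ne_zero' ℝ)] at e3
  rw [e1]
  refine (Lp.lintegral_translate_sub_sq_le (complexify u) hs h).trans ?_
  rw [e2, e3]
  refine (mul_le_mul_right (add_le_add hL2 hfr) _).trans_eq ?_
  rw [← ENNReal.ofReal_add (by positivity) (by positivity), ← ENNReal.ofReal_mul (by positivity)]
  congr 1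
  ring

end FracSobolev

theorem theorem3p1 (N : ℕ) (hN : 3 ≤ N)
    (V : EuclideanSpace ℝ (Fin N) → ℝ) (hV : FracSobolev.IsPotential V)
    (r : ℝ) (hr : 0 < r)
    (q : ℝ) (hq : 2 ≤ q) (hq' : q < 2 * (N : ℝ) / ((N : ℝ) - 1))
    (s : ℕ → ℝ) (hs : ∀ n, s n ∈ Set.Ioo (1 / 2 : ℝ) 1)
    (u : ℕ → FracSobolev.L2 N) (hu : ∀ n, u n ∈ FracSobolev.Hs N (s n))
    (M : ℝ) (hM : 0 < M)
    (hbound : ∀ n, FracSobolev.sNorm V (s n) (u n) ≤ ENNReal.ofReal M)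
    (hvanish : Tendsto
      (fun n => ⨆ y : EuclideanSpace ℝ (Fin N), ∫⁻ x in Metric.ball y r, ‖u n x‖ₑ ^ q)
      atTop (𝓝 0))
    (p : ℝ) (hp : p ∈ Set.Ioo (2 : ℝ) (2 * (N : ℝ) / ((N : ℝ) - 1))) :
    (∀ n, MemLp (u n) (ENNReal.ofReal p) volume) ∧
      Tendsto (fun n => eLpNorm (u n) (ENNReal.ofReal p) volume) atTop (𝓝 0) := by
  obtain ⟨c, hc, hcV⟩ := hV.inf_pos
  have hb := fun n => FracSobolev.nikolskiiBound_of_sNorm_le hc hcV hM.le (hs n).1.le (hbound n)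
  have hK : 0 ≤ 2 * (M ^ 2 / c + M ^ 2) := by positivity
  have hp0 : 0 < p := two_pos.trans hp.1
  have hfr : Module.finrank ℝ (EuclideanSpace ℝ (Fin N)) = N := finrank_euclideanSpace_fin
  have hd : 2 ≤ Module.finrank ℝ (EuclideanSpace ℝ (Fin N)) := by omega
  have hcrit : p < 2 * (Module.finrank ℝ (EuclideanSpace ℝ (Fin N)) : ℝ) /
      ((Module.finrank ℝ (EuclideanSpace ℝ (Fin N)) : ℝ) - 1) := by
    rw [hfr]
    exact hp.2
  have hm : ∀ n, Measurable (u n) := fun n => (Lp.stronglyMeasurable (u n)).measurable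
  have hnorm : ∀ n, eLpNorm (u n) (ENNReal.ofReal p) volume =
      (∫⁻ x, ‖u n x‖ₑ ^ p) ^ (1 / p) := fun n => by
    rw [eLpNorm_eq_lintegral_rpow_enorm_toReal (by simpa using hp0) ENNReal.ofReal_ne_top,
      ENNReal.toReal_ofReal hp0.le]
  obtain ⟨C, hC⟩ := NikolskiiBound.exists_lintegral_rpow_le
    (E := EuclideanSpace ℝ (Fin N)) (A := M ^ 2 / c) hd hp.1 hcrit hK
  refine ⟨fun n => ⟨Lp.aestronglyMeasurable (u n), ?_⟩, ?_⟩
  · rw [hnorm]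
    exact ENNReal.rpow_lt_top_of_nonneg (by positivity)
      (ne_top_of_le_ne_top ENNReal.ofReal_ne_top (hC _ (hm n) (hb n).2 (hb n).1))
  · simp only [hnorm]
    have h := tendsto_lintegral_rpow_of_vanishing hd hp.1 hcrit hK (two_pos.trans_le hq) hr hm
      (fun n => (hb n).2) (fun n => (hb n).1) hvanish
    have h2 := h.ennrpow_const (1 / p)
    rwa [ENNReal.zero_rpow_of_pos (by positivity)] at h2
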